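/- **Theorem.** Throughout, Hilbert spaces are complex, $\mathbb{D}=\{z\in\mathbb{C}:|z|<1\}$, $\mathbb{C}_+=\{s\in\mathbb{C}:\operatorname{Re}s>0\}$, and $p_1=2,\ p_2=3,\dots$ are the primes in increasing order. For $N\ge 1$ let $\mathcal{A}_N$ be the set of analytic functions $f:\mathbb{D}^N\to\overline{\mathbb{D}}$ such that $\|f(T)\|\le 1$ for every $N$-tuple $T=(T_1,\dots,T_N)$ of pairwise commuting bounded operators on a Hilbert space with $\|T_j\|<1$ for all $j$, where $f(T)=\sum_\alpha c_\alpha T^\alpha$ is defined by the absolutely convergent power series $f(z)=\sum_\alpha c_\alpha z^\alpha$ of $f$ on $\mathbb{D}^N$. Let $Ball(c_{00})$ be the set of finitely supported complex sequences $(z_1,z_2,\dots)$ with $|z_j|<1$ for all $j$, and let $\mathcal{A}_\infty$ be the set of functions $F:Ball(c_{00})\to\mathbb{C}$ such that for every $N\ge 1$ the function $(z_1,\dots,z_N)\mapsto F(z_1,\dots,z_N,0,0,\dots)$ belongs to $\mathcal{A}_N$. Such an $F$ extends to every sequence $z$ with $|z_j|<1$ for all $j$ and $z_j\to 0$ by $F(z):=\lim_{N\to\infty}F(z_1,\dots,z_N,0,0,\dots)$,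 and this limit exists. Let $\mathscr{A}^\infty$ be the set of functions on $\mathbb{C}_+$ of the form $$f(s)=F(p_1^{-s},p_2^{-s},p_3^{-s},\dots),\qquad s\in\mathbb{C}_+,\quad F\in\mathcal{A}_\infty .$$ Let $f\in\mathscr{A}^\infty$, and let $M$ be a bounded operator on a Hilbert space such that $\sigma(M)\subset\mathbb{C}_+$ and $\|n^{-M}\|\le 1$ for every $n\in\{1,2,3,\dots\}$. Then $$\|f(M)\|\le 1 .$$ Here $n^{-M}$ and $f(M)$ are given by the Riesz holomorphic functional calculus: $g(M)=\frac{1}{2\pi i}\oint_\Gamma g(z)(z-M)^{-1}\,dz$ for $g$ holomorphic on $\mathbb{C}_+$, where $\Gamma$ is a positively oriented circle such that the closed disc that it bounds lies in $\mathbb{C}_+$ and the open disc contains $\sigma(M)$ (such circles exist, and the value does not depend on the choice), and $n^{-M}$ is $g(M)$ for $g(s)=n^{-s}$. -/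

import Mathlib

open Filter Topology Metric Set

universe u

namespace SchurAgler

/-! ### Holomorphic functions on the polydisc and the Agler class in finitely many variables -/

/-- The open unit polydisc `𝔻^N`. -/
def polydisc (N : ℕ) : Set (Fin N → ℂ) := {z | ∀ j, ‖z j‖ < 1}

/-- `f` belongs to the Schur class in `N` variables: it is analytic on `𝔻^N` with values in the
closed unit disc.  (Values of `f` off `𝔻^N` are irrelevant.) -/
structure SchurClass (N : ℕ) (f : (Fin N → ℂ) → ℂ) : Prop where
  analytic : AnalyticOnNhd ℂ f (polydisc N)
  norm_le_one : ∀ z ∈ polydisc N, ‖f z‖ ≤ 1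

/-- The family `c` consists of the power series coefficients of `f` on `𝔻^N`:
`f(z) = ∑_α c_α z^α` for all `z ∈ 𝔻^N`, with unconditional, i.e. absolute, convergence. -/
def IsPowerSeries {N : ℕ} (f : (Fin N → ℂ) → ℂ) (c : (Fin N → ℕ) → ℂ) : Prop :=
  ∀ z ∈ polydisc N, HasSum (fun α : Fin N → ℕ => c α * ∏ j, z j ^ α j) (f z)

section Operators

variable {H : Type u} [NormedAddCommGroup H] [InnerProductSpace ℂ H]

/-- The monomial `T^α = T_1^{α_1} ⋯ T_N^{α_N}` in a (commuting) tuple of operators. -/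
def opMonomial {N : ℕ} (T : Fin N → (H →L[ℂ] H)) (α : Fin N → ℕ) : H →L[ℂ] H :=
  (List.ofFn fun j => T j ^ α j).prod

/-- The value `∑_α c_α T^α` of the power series with coefficients `c` at the tuple `T`. -/
noncomputable def opPowerSeries {N : ℕ} (c : (Fin N → ℕ) → ℂ) (T : Fin N → (H →L[ℂ] H)) :
    H →L[ℂ] H :=
  ∑' α : Fin N → ℕ, c α • opMonomial T α

end Operators

theorem summable_prod_pow {N : ℕ} (r : Fin N → ℝ) (h0 : ∀ j, 0 ≤ r j) (h1 : ∀ j, r j < 1) :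
    Summable (fun α : Fin N → ℕ => ∏ j, r j ^ α j) := by
  induction N with
  | zero => exact (hasSum_fintype _).summable
  | succ N ih =>
    have hs := (summable_geometric_of_lt_one (h0 0) (h1 0)).mul_of_nonneg
      (ih (fun j => r j.succ) (fun j => h0 _) (fun j => h1 _))
      (fun k => pow_nonneg (h0 0) k)
      (fun α => Finset.prod_nonneg fun j _ => pow_nonneg (h0 _) _)
    rw [← (Fin.consEquiv (fun _ : Fin (N + 1) => ℕ)).summable_iff]
    refine hs.congr fun p => ?_
    simp [Fin.consEquiv, Fin.prod_univ_succ]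

theorem isOpen_polydisc (N : ℕ) : IsOpen (polydisc N) := by
  have : polydisc N = ⋂ j, {z : Fin N → ℂ | ‖z j‖ < 1} := by ext; simp [polydisc]
  rw [this]
  exact isOpen_iInter_of_finite fun j => isOpen_lt (by fun_prop) continuous_const

theorem cons_mem_polydisc {N : ℕ} {t : ℂ} {z : Fin N → ℂ} (ht : ‖t‖ < 1) (hz : z ∈ polydisc N) :
    (Fin.cons t z : Fin (N + 1) → ℂ) ∈ polydisc (N + 1) := by
  intro j
  refine Fin.cases ?_ (fun i => ?_) j
  · simpa using ht
  · simpa using hz i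

theorem hasDerivAt_cons {N : ℕ} (z : Fin N → ℂ) (t : ℂ) :
    HasDerivAt (fun t : ℂ => (Fin.cons t z : Fin (N + 1) → ℂ)) (Pi.single 0 1) t := by
  rw [hasDerivAt_pi]
  intro j
  refine Fin.cases ?_ (fun i => ?_) j
  · simpa using! hasDerivAt_id t
  · simpa using hasDerivAt_const t (z i)

theorem analyticAt_cons {N : ℕ} (z : Fin N → ℂ) :
    AnalyticAt ℂ (fun z : Fin N → ℂ => (Fin.cons 0 z : Fin (N + 1) → ℂ)) z := by
  rw [analyticAt_pi_iff]
  intro j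
  refine Fin.cases ?_ (fun i => ?_) j
  · simpa using analyticAt_const
  · simpa using! (ContinuousLinearMap.proj (R := ℂ) (φ := fun _ : Fin N => ℂ) i).analyticAt z

theorem exists_coeff {N : ℕ} {f : (Fin N → ℂ) → ℂ} {C : ℝ} (hf : AnalyticOnNhd ℂ f (polydisc N))
    (hC : ∀ z ∈ polydisc N, ‖f z‖ ≤ C) :
    ∃ c : (Fin N → ℕ) → ℂ, (∀ α, ‖c α‖ ≤ C) ∧ IsPowerSeries f c := by
  induction N with
  | zero =>
    refine ⟨fun _ => f 0, fun _ => hC 0 (fun j => j.elim0), fun z _ => ?_⟩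
    have hz : z = 0 := Subsingleton.elim _ _
    subst hz
    simp
  | succ N ih =>
    let D : ((Fin (N + 1) → ℂ) → ℂ) → ((Fin (N + 1) → ℂ) → ℂ) :=
      fun g z => fderiv ℂ g z (Pi.single 0 1)
    have hD : ∀ k, AnalyticOnNhd ℂ (D^[k] f) (polydisc (N + 1)) := by
      intro k
      induction k with
      | zero => exact hf
      | succ k ihk =>
        rw [Function.iterate_succ_apply']
        intro z hz
        exact (ContinuousLinearMap.apply ℂ ℂ (Pi.single 0 1 : Fin (N + 1) → ℂ)).analyticAt _ |>.comp
          (ihk.fderiv z hz)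
    have hder : ∀ z ∈ polydisc N, ∀ k, ∀ t : ℂ, ‖t‖ < 1 →
        HasDerivAt (fun t => (D^[k] f) (Fin.cons t z)) ((D^[k + 1] f) (Fin.cons t z)) t := by
      intro z hz k t ht
      rw [Function.iterate_succ_apply']
      exact ((hD k _ (cons_mem_polydisc ht hz)).differentiableAt.hasFDerivAt).comp_hasDerivAt t
        (hasDerivAt_cons z t)
    have hit : ∀ z ∈ polydisc N, ∀ k, ∀ t : ℂ, ‖t‖ < 1 →
        iteratedDeriv k (fun t => f (Fin.cons t z)) t = (D^[k] f) (Fin.cons t z) := by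
      intro z hz k
      induction k with
      | zero => intro t _; simp
      | succ k ihk =>
        intro t ht
        rw [iteratedDeriv_succ]
        have he : iteratedDeriv k (fun t => f (Fin.cons t z)) =ᶠ[𝓝 t]
            fun t => (D^[k] f) (Fin.cons t z) := by
          have : {t : ℂ | ‖t‖ < 1} ∈ 𝓝 t :=
            (isOpen_lt continuous_norm continuous_const).mem_nhds ht
          filter_upwards [this] with s hs using ihk s hs
        rw [he.deriv_eq, (hder z hz k t ht).deriv]
    let a : ℕ → (Fin N → ℂ) → ℂ := fun k z => (k.factorial : ℂ)⁻¹ * (D^[k] f) (Fin.cons 0 z)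
    have hdiff : ∀ z ∈ polydisc N, DifferentiableOn ℂ (fun t => f (Fin.cons t z)) (ball 0 1) := by
      intro z hz t ht
      have ht' : ‖t‖ < 1 := by simpa using ht
      exact (hder z hz 0 t ht').differentiableAt.differentiableWithinAt
    have ha : ∀ k, AnalyticOnNhd ℂ (a k) (polydisc N) := by
      intro k z hz
      refine analyticAt_const.mul ?_
      exact (hD k _ (cons_mem_polydisc (by simp) hz)).comp (analyticAt_cons z)
    have hab : ∀ k, ∀ z ∈ polydisc N, ‖a k z‖ ≤ C := by
      intro k z hz
      have key : ∀ R : ℝ, 0 < R → R < 1 → ‖a k z‖ * R ^ k ≤ C := by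
        intro R hR hR1
        have h := Complex.norm_iteratedDeriv_le_of_forall_mem_sphere_norm_le (c := 0) (C := C) k hR
          (((hdiff z hz).mono (closedBall_subset_ball hR1)).diffContOnCl_ball subset_rfl)
          (by
            intro t ht
            refine hC _ (cons_mem_polydisc ?_ hz)
            rw [mem_sphere_zero_iff_norm.1 ht]; exact hR1)
        rw [hit z hz k 0 (by simp)] at h
        have hk : (0 : ℝ) < k.factorial := by positivity
        rw [le_div_iff₀ (pow_pos hR k)] at h
        simp only [a, norm_mul, norm_inv, Complex.norm_natCast]
        rw [mul_assoc, inv_mul_le_iff₀ hk]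
        exact h
      have hlim : Tendsto (fun R : ℝ => ‖a k z‖ * R ^ k) (𝓝[<] 1) (𝓝 (‖a k z‖ * 1 ^ k)) :=
        ((continuous_const.mul (continuous_id.pow k)).tendsto 1).mono_left nhdsWithin_le_nhds
      rw [one_pow, mul_one] at hlim
      refine le_of_tendsto hlim ?_
      filter_upwards [Ioo_mem_nhdsLT (zero_lt_one' ℝ)] with R hR using key R hR.1 hR.2
    choose c hcb hc using fun k => ih (ha k) (hab k)
    refine ⟨fun α => c (α 0) (Fin.tail α), fun α => hcb _ _, fun z hz => ?_⟩
    have hz' : Fin.tail z ∈ polydisc N := fun j => hz j.succ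
    have hC0 : 0 ≤ C := (norm_nonneg _).trans (hC z hz)
    rw [← (Fin.consEquiv (fun _ : Fin (N + 1) => ℕ)).hasSum_iff]
    have hform : ((fun α : Fin (N + 1) → ℕ => c (α 0) (Fin.tail α) * ∏ j, z j ^ α j) ∘
        (Fin.consEquiv (fun _ : Fin (N + 1) => ℕ))) =
        fun p : ℕ × (Fin N → ℕ) => z 0 ^ p.1 * (c p.1 p.2 * ∏ j, Fin.tail z j ^ p.2 j) := by
      funext p
      simp only [Function.comp, Fin.consEquiv, Equiv.coe_fn_mk, Fin.prod_univ_succ, Fin.cons_zero,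
        Fin.cons_succ, Fin.tail_cons, Fin.tail]
      ring
    rw [hform]
    have hsum : Summable fun p : ℕ × (Fin N → ℕ) =>
        z 0 ^ p.1 * (c p.1 p.2 * ∏ j, Fin.tail z j ^ p.2 j) := by
      have hs := (summable_geometric_of_lt_one (norm_nonneg (z 0)) (hz 0)).mul_of_nonneg
        (summable_prod_pow (fun j => ‖Fin.tail z j‖) (fun j => norm_nonneg _) hz')
        (fun k => pow_nonneg (norm_nonneg _) k)
        (fun α => Finset.prod_nonneg fun j _ => pow_nonneg (norm_nonneg _) _)
      refine Summable.of_norm_bounded (hs.mul_left C) fun p => ?_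
      simp only [norm_mul, norm_pow, norm_prod]
      have hp : 0 ≤ ‖z 0‖ ^ p.1 * ∏ j, ‖Fin.tail z j‖ ^ p.2 j := by positivity
      nlinarith [mul_le_mul_of_nonneg_right (hcb p.1 p.2) hp]
    have h1 := hsum.hasSum.prod_fiberwise (fun k => (hc k _ hz').mul_left (z 0 ^ k))
    have h2 := Complex.hasSum_taylorSeries_on_ball (hdiff _ hz') (z := z 0)
      (by simpa using hz 0)
    have h3 : HasSum (fun k => z 0 ^ k * a k (Fin.tail z)) (f z) := by
      have hcons : (Fin.cons (z 0) (Fin.tail z) : Fin (N + 1) → ℂ) = z := Fin.cons_self_tail z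
      rw [hcons] at h2
      refine h2.congr_fun fun k => ?_
      rw [hit _ hz' k 0 (by simp)]
      simp only [a, smul_eq_mul, sub_zero]
      ring
    rw [← h1.unique h3]
    exact hsum.hasSum

/-- Every function in the Schur class has a power series on the polydisc. -/
theorem SchurClass.exists_isPowerSeries {N : ℕ} {f : (Fin N → ℂ) → ℂ} (hf : SchurClass N f) :
    ∃ c, IsPowerSeries f c :=
  let ⟨c, _, hc⟩ := exists_coeff hf.analytic hf.norm_le_one
  ⟨c, hc⟩

theorem norm_opMonomial_le {H : Type u} [NormedAddCommGroup H] [InnerProductSpace ℂ H] {N : ℕ}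
    (T : Fin N → (H →L[ℂ] H)) (α : Fin N → ℕ) :
    ‖opMonomial T α‖ ≤ ∏ j, ‖T j‖ ^ α j := by
  have h1 : ‖(1 : H →L[ℂ] H)‖ ≤ 1 := ContinuousLinearMap.norm_id_le
  have hpow : ∀ (A : H →L[ℂ] H) (n : ℕ), ‖A ^ n‖ ≤ ‖A‖ ^ n := by
    intro A n
    induction n with
    | zero => simpa using h1
    | succ n ih =>
      rw [pow_succ, pow_succ]
      exact (norm_mul_le _ _).trans (mul_le_mul_of_nonneg_right ih (norm_nonneg _))
  unfold opMonomial
  induction N with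
  | zero => simpa using h1
  | succ N ih =>
    rw [List.ofFn_succ, List.prod_cons, Fin.prod_univ_succ]
    exact (norm_mul_le _ _).trans
      (mul_le_mul (hpow _ _) (ih (fun j => T j.succ) (fun j => α j.succ)) (norm_nonneg _)
        (by positivity))

/-- The power series of a function on `𝔻^N` converges absolutely at each tuple of strict
contractions. -/
theorem IsPowerSeries.summable_norm {H : Type u} [NormedAddCommGroup H] [InnerProductSpace ℂ H]
    {N : ℕ} {f : (Fin N → ℂ) → ℂ} {c : (Fin N → ℕ) → ℂ} (hc : IsPowerSeries f c)
    (T : Fin N → (H →L[ℂ] H)) (hT : ∀ j, ‖T j‖ < 1) :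
    Summable fun α => ‖c α • opMonomial T α‖ := by
  have h := (hc (fun j => (‖T j‖ : ℂ)) (fun j => by simpa using hT j)).summable.norm
  refine h.of_nonneg_of_le (fun α => norm_nonneg _) fun α => ?_
  rw [norm_smul, norm_mul]
  refine mul_le_mul_of_nonneg_left ((norm_opMonomial_le T α).trans_eq ?_) (norm_nonneg _)
  simp

/-- `f` belongs to the Agler class in `N` variables: it is in the Schur class, and
`‖f(T)‖ ≤ 1` for every commuting `N`-tuple `T` of strict contractions on a complex Hilbert space,
where `f(T)` is the value at `T` of the power series of `f`.  The power series exists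
(`SchurClass.exists_isPowerSeries`), and it converges absolutely at `T`
(`IsPowerSeries.summable_norm`). -/
structure AglerClass (N : ℕ) (f : (Fin N → ℂ) → ℂ) : Prop where
  schur : SchurClass N f
  vonNeumann : ∀ c : (Fin N → ℕ) → ℂ, IsPowerSeries f c →
    ∀ (H : Type u) [NormedAddCommGroup H] [InnerProductSpace ℂ H] [CompleteSpace H]
      (T : Fin N → (H →L[ℂ] H)), (∀ i j, Commute (T i) (T j)) → (∀ j, ‖T j‖ < 1) →
      ‖opPowerSeries c T‖ ≤ 1

/-! ### The Agler class in infinitely many variables -/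

/-- The identification of `ℂ^N` with `ℂ^N × {(0, 0, …)} ⊆ c₀₀`; here `c₀₀` is `ℕ →₀ ℂ`,
and the coordinates are numbered from `0`. -/
noncomputable def padZero (N : ℕ) (z : Fin N → ℂ) : ℕ →₀ ℂ :=
  Finsupp.onFinset (Finset.range N) (fun j => if h : j < N then z ⟨j, h⟩ else 0) (by
    intro j hj
    by_contra h
    simp only [Finset.mem_range] at h
    simp [h] at hj)

/-- `F` belongs to the Agler class in infinitely many variables: its restriction to each `𝔻^N`
belongs to the Agler class in `N` variables.  Only the values of `F` on the open unit ball of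
`c₀₀` matter. -/
def AglerClassInfty (F : (ℕ →₀ ℂ) → ℂ) : Prop :=
  ∀ N : ℕ, AglerClass.{u} N (fun z => F (padZero N z))

/-- The value at `z ∈ Ball(c₀)` of a function `F` given on `Ball(c₀₀)`, namely
`lim_N F(z_1, …, z_N, 0, 0, …)`.  For `F` in the Agler class the limit exists, by
`AglerClassInfty.tendsto_extend`. -/
noncomputable def extend (F : (ℕ →₀ ℂ) → ℂ) (z : ℕ → ℂ) : ℂ :=
  limUnder atTop (fun N : ℕ => F (padZero N fun j => z j))

theorem padZero_apply (N : ℕ) (z : Fin N → ℂ) (j : ℕ) :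
    padZero N z j = if h : j < N then z ⟨j, h⟩ else 0 := rfl

/-- For `F` in the Agler class, `F(z_1, …, z_N, 0, 0, …)` converges at each `z ∈ Ball(c₀)`. -/
theorem AglerClassInfty.tendsto_extend {F : (ℕ →₀ ℂ) → ℂ} (hF : AglerClassInfty.{u} F)
    {z : ℕ → ℂ} (hz : ∀ j, ‖z j‖ < 1) (hz0 : Tendsto z atTop (𝓝 0)) :
    Tendsto (fun N : ℕ => F (padZero N fun j => z j)) atTop (𝓝 (extend F z)) := by
  refine CauchySeq.tendsto_limUnder ?_
  refine Metric.cauchySeq_iff'.2 fun ε hε => ?_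
  obtain ⟨δ, hδ0, hδ⟩ : ∃ δ : ℝ, 0 < δ ∧ δ < min 1 (ε / 2) :=
    exists_between (lt_min one_pos (by positivity))
  have hδ1 : δ < 1 := hδ.trans_le (min_le_left _ _)
  have hδε : 2 * δ < ε := by linarith [hδ.trans_le (min_le_right 1 (ε / 2))]
  obtain ⟨N, hN⟩ := Metric.tendsto_atTop.1 hz0 δ hδ0
  refine ⟨N, fun M hM => ?_⟩
  let w : ℂ → Fin M → ℂ := fun t j => if (j : ℕ) < N then z j else t * (z j / δ)
  have hw : ∀ t : ℂ, ‖t‖ < 1 → w t ∈ polydisc M := by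
    intro t ht j
    by_cases hj : (j : ℕ) < N
    · simpa [w, hj] using hz j
    · have h1 : ‖z j‖ < δ := by simpa using hN j (not_lt.1 hj)
      have h2 : ‖z j / δ‖ ≤ 1 := by
        rw [norm_div, Complex.norm_real, Real.norm_of_nonneg hδ0.le, div_le_one hδ0]
        exact h1.le
      simp only [w, hj, if_false, norm_mul]
      calc ‖t‖ * ‖z j / δ‖ ≤ ‖t‖ * 1 := mul_le_mul_of_nonneg_left h2 (norm_nonneg _)
        _ < 1 := by simpa using ht
  have hwd : Differentiable ℂ w := by
    rw [differentiable_pi]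
    intro j
    by_cases hj : (j : ℕ) < N
    · simp [w, hj]
    · simp only [w, hj, if_false]; fun_prop
  let g : ℂ → ℂ := fun t => F (padZero M (w t))
  have hg : DifferentiableOn ℂ g (ball 0 1) := by
    intro t ht
    have := ((hF M).schur.analytic _ (hw t (by simpa using ht))).differentiableAt
    exact (this.comp t (hwd t)).differentiableWithinAt
  have hgb : ∀ t ∈ ball (0 : ℂ) 1, ‖g t‖ ≤ 1 := fun t ht =>
    (hF M).schur.norm_le_one _ (hw t (by simpa using ht))
  have hmaps : MapsTo g (ball 0 1) (closedBall (g 0) 2) := by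
    intro t ht
    rw [mem_closedBall, dist_eq_norm]
    linarith [norm_sub_le (g t) (g 0), hgb t ht, hgb 0 (by simp)]
  have hS := Complex.dist_le_div_mul_dist_of_mapsTo_ball hg hmaps (z := (δ : ℂ))
    (by simpa [abs_of_pos hδ0] using hδ1)
  have hgδ : g δ = F (padZero M fun j => z j) := by
    have : w δ = fun j : Fin M => z j := by
      funext j
      have : (δ : ℂ) ≠ 0 := by exact_mod_cast hδ0.ne'
      by_cases hj : (j : ℕ) < N
      · simp [w, hj]
      · simp only [w, hj, if_false]; field_simp
    simp only [g, this]
  have hg0 : g 0 = F (padZero N fun j => z j) := by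
    have : padZero M (w 0) = padZero N fun j => z j := by
      ext j
      simp only [padZero_apply, w]
      by_cases hj : j < N
      · simp [hj, hj.trans_le hM]
      · simp [hj]
    simp only [g, this]
  rw [hgδ, hg0] at hS
  refine hS.trans_lt ?_
  simpa [abs_of_pos hδ0] using hδε

/-! ### Dirichlet series -/

/-- The open right half plane `ℂ_+`. -/
def rightHalfPlane : Set ℂ := {s | 0 < s.re}

/-- The sequence `(p_1^{-s}, p_2^{-s}, …)`, where `p_1 = 2, p_2 = 3, …` are the primes. -/
noncomputable def primePowers (s : ℂ) (j : ℕ) : ℂ := (Nat.nth Nat.Prime j : ℂ) ^ (-s)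

theorem norm_primePowers_lt_one {s : ℂ} (hs : s ∈ rightHalfPlane) (j : ℕ) :
    ‖primePowers s j‖ < 1 := by
  have hp : (Nat.nth Nat.Prime j).Prime := Nat.prime_nth_prime j
  have hs' : 0 < s.re := hs
  rw [primePowers, Complex.norm_natCast_cpow_of_pos hp.pos]
  exact Real.rpow_lt_one_of_one_lt_of_neg (by exact_mod_cast hp.one_lt) (by simpa using hs')

theorem tendsto_primePowers {s : ℂ} (hs : s ∈ rightHalfPlane) :
    Tendsto (primePowers s) atTop (𝓝 0) := by
  have hs' : 0 < s.re := hs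
  rw [tendsto_zero_iff_norm_tendsto_zero]
  have h1 : Tendsto (fun j => (Nat.nth Nat.Prime j : ℝ)) atTop atTop :=
    tendsto_natCast_atTop_atTop.comp
      (Nat.nth_strictMono Nat.infinite_setOfPred_prime).tendsto_atTop
  refine ((tendsto_rpow_neg_atTop hs').comp h1).congr fun j => ?_
  rw [primePowers, Complex.norm_natCast_cpow_of_pos (Nat.prime_nth_prime j).pos]
  simp

/-- The class `𝒜^∞`: the functions `f(s) = F(p_1^{-s}, p_2^{-s}, …)` on `ℂ_+`, with `F` in the
Agler class in infinitely many variables. -/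
def DirichletAgler : Set (ℂ → ℂ) :=
  {f | ∃ F : (ℕ →₀ ℂ) → ℂ, AglerClassInfty.{u} F ∧
    ∀ s ∈ rightHalfPlane, f s = extend F (primePowers s)}

/-! ### The Riesz holomorphic functional calculus -/

section Riesz

variable {H : Type u} [NormedAddCommGroup H] [InnerProductSpace ℂ H]

/-- The positively oriented circle with centre `c` and radius `R` is an admissible contour for `M`
and functions that are holomorphic on `ℂ_+`: the closed disc lies in `ℂ_+`, and the open disc
contains the spectrum of `M`. -/
structure IsRieszCircle (M : H →L[ℂ] H) (c : ℂ) (R : ℝ) : Prop where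
  pos : 0 < R
  closedBall_subset : closedBall c R ⊆ rightHalfPlane
  spectrum_subset : spectrum ℂ M ⊆ ball c R

/-- The Riesz integral `(2πi)⁻¹ ∮_{|z - c| = R} g(z) (z - M)⁻¹ dz`. -/
noncomputable def rieszIntegral (M : H →L[ℂ] H) (g : ℂ → ℂ) (c : ℂ) (R : ℝ) : H →L[ℂ] H :=
  (2 * (Real.pi : ℂ) * Complex.I)⁻¹ • ∮ z in C(c, R), g z • resolvent M z

open Classical in
/-- The operator `g(M)` of the Riesz holomorphic functional calculus, for `g` holomorphic on `ℂ_+`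
and `σ(M) ⊆ ℂ_+`: the Riesz integral over a circle in `ℂ_+` that encloses the spectrum.  Such
circles exist (`exists_isRieszCircle`), and the integral does not depend on the choice
(`rieszCalculus_eq`). -/
noncomputable def rieszCalculus (M : H →L[ℂ] H) (g : ℂ → ℂ) : H →L[ℂ] H :=
  if h : ∃ p : ℂ × ℝ, IsRieszCircle M p.1 p.2 then
    rieszIntegral M g h.choose.1 h.choose.2
  else 0

end Riesz

section RieszFacts

variable {H : Type u} [NormedAddCommGroup H] [InnerProductSpace ℂ H] [CompleteSpace H]

/-- If `σ(M) ⊆ ℂ_+`, then some circle in `ℂ_+` encloses the spectrum. -/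
theorem exists_isRieszCircle {M : H →L[ℂ] H} (hM : spectrum ℂ M ⊆ rightHalfPlane) :
    ∃ p : ℂ × ℝ, IsRieszCircle M p.1 p.2 := by
  have hK : IsCompact (spectrum ℂ M) := spectrum.isCompact M
  obtain ⟨a, ha, haK⟩ : ∃ a : ℝ, 0 < a ∧ ∀ z ∈ spectrum ℂ M, a ≤ z.re := by
    rcases (spectrum ℂ M).eq_empty_or_nonempty with h | h
    · exact ⟨1, one_pos, by simp [h]⟩
    · obtain ⟨z, hz, hmin⟩ := hK.exists_isMinOn h Complex.continuous_re.continuousOn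
      exact ⟨z.re, hM hz, fun w hw => hmin hw⟩
  obtain ⟨B, hB⟩ := hK.isBounded.exists_norm_le
  set r : ℝ := B ^ 2 / a + a + 1 with hr
  have hra : a < r := by
    have : 0 ≤ B ^ 2 / a := by positivity
    linarith
  have hra2 : B ^ 2 < r * a := by
    have : B ^ 2 / a * a = B ^ 2 := by field_simp
    nlinarith
  refine ⟨((r : ℂ), r - a / 2), by simpa using by linarith, fun z hz => ?_, fun z hz => ?_⟩
  · have h1 : ‖z - r‖ ≤ r - a / 2 := by simpa [dist_eq_norm] using hz
    have h2 := (Complex.abs_re_le_norm (z - r)).trans h1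
    rw [Complex.sub_re, Complex.ofReal_re, abs_le] at h2
    simp only [rightHalfPlane, mem_ofPred_eq]
    linarith
  · rw [mem_ball, dist_eq_norm]
    refine lt_of_pow_lt_pow_left₀ 2 (by simpa using by linarith) ?_
    have h1 := haK z hz
    have h2 : ‖z‖ ^ 2 ≤ B ^ 2 := pow_le_pow_left₀ (norm_nonneg _) (hB z hz) 2
    rw [Complex.sq_norm, Complex.normSq_apply] at h2 ⊢
    simp only [Complex.sub_re, Complex.sub_im, Complex.ofReal_re, Complex.ofReal_im]
    nlinarith

theorem circleIntegral_eq_of_homotopy {E : Type u} [NormedAddCommGroup E] [NormedSpace ℂ E]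
    [CompleteSpace E] {U : Set ℂ} (hU : IsOpen U) {G : ℂ → E} (hG : DifferentiableOn ℂ G U)
    {c₀ c₁ : ℂ} {R₀ R₁ : ℝ}
    (h : ∀ t ∈ Icc (0 : ℝ) 1, ∀ θ : ℝ,
      circleMap (c₀ + t * (c₁ - c₀)) (R₀ + t * (R₁ - R₀)) θ ∈ U) :
    (∮ z in C(c₀, R₀), G z) = ∮ z in C(c₁, R₁), G z := by
  let e : ℝ → ℂ := fun θ => Complex.exp (θ * Complex.I)
  let r : ℝ → ℂ := fun t => R₀ + t * (R₁ - R₀)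
  let γ : ℝ → ℝ → ℂ := fun t θ => c₀ + t * (c₁ - c₀) + r t * e θ
  let u : ℝ → ℂ := fun θ => (c₁ - c₀) + (R₁ - R₀) * e θ
  have hγ : ∀ t θ : ℝ, circleMap (c₀ + t * (c₁ - c₀)) (R₀ + t * (R₁ - R₀)) θ = γ t θ := by
    intro t θ; simp [circleMap, γ, r, e]
  have hγU : ∀ t ∈ Icc (0 : ℝ) 1, ∀ θ, γ t θ ∈ U := fun t ht θ => hγ t θ ▸ h t ht θ
  let k : ℝ → ℝ → E := fun t θ => (r t * (e θ * Complex.I)) • G (γ t θ)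
  let k' : ℝ → ℝ → E := fun t θ =>
    ((R₁ - R₀) * (e θ * Complex.I)) • G (γ t θ) +
      (r t * (e θ * Complex.I)) • (u θ • deriv G (γ t θ))
  have hGd : ∀ z ∈ U, HasDerivAt G (deriv G z) z := fun z hz =>
    (hG.differentiableAt (hU.mem_nhds hz)).hasDerivAt
  have hGc : ContinuousOn G U := hG.continuousOn
  have hG'c : ContinuousOn (deriv G) U := (hG.deriv hU).continuousOn
  have hec : Continuous e := by fun_prop
  have hγc : Continuous fun p : ℝ × ℝ => γ p.1 p.2 := by fun_prop
  have hS : ∀ p ∈ Icc (0 : ℝ) 1 ×ˢ (univ : Set ℝ), γ p.1 p.2 ∈ U := fun p hp => hγU p.1 hp.1 p.2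
  have hkc : ContinuousOn (fun p : ℝ × ℝ => k p.1 p.2) (Icc 0 1 ×ˢ univ) := by
    refine ContinuousOn.smul (Continuous.continuousOn (by fun_prop)) ?_
    exact hGc.comp hγc.continuousOn hS
  have hk'c : ContinuousOn (fun p : ℝ × ℝ => k' p.1 p.2) (Icc 0 1 ×ˢ univ) := by
    refine ContinuousOn.add (ContinuousOn.smul (Continuous.continuousOn (by fun_prop)) ?_)
      (ContinuousOn.smul (Continuous.continuousOn (by fun_prop))
        (ContinuousOn.smul (Continuous.continuousOn (by fun_prop)) ?_))
    · exact hGc.comp hγc.continuousOn hS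
    · exact hG'c.comp hγc.continuousOn hS
  have hkθ : ∀ t ∈ Icc (0 : ℝ) 1, Continuous (k t) := fun t ht =>
    hkc.comp_continuous (f := fun θ : ℝ => (t, θ)) (by fun_prop) fun θ => ⟨ht, mem_univ _⟩
  have hk'θ : ∀ t ∈ Icc (0 : ℝ) 1, Continuous (k' t) := fun t ht =>
    hk'c.comp_continuous (f := fun θ : ℝ => (t, θ)) (by fun_prop) fun θ => ⟨ht, mem_univ _⟩
  have hγt : ∀ t θ : ℝ, HasDerivAt (fun t => γ t θ) (u θ) t := by
    intro t θ
    have h1 : HasDerivAt (fun t : ℝ => (t : ℂ)) 1 t := Complex.ofRealCLM.hasDerivAt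
    have h2 := ((h1.mul_const (c₁ - c₀)).const_add c₀).add
      (((h1.mul_const ((R₁ : ℂ) - R₀)).const_add (R₀ : ℂ)).mul_const (e θ))
    simpa [γ, r, u] using! h2
  have heθ : ∀ θ : ℝ, HasDerivAt e (e θ * Complex.I) θ := by
    intro θ
    have h1 : HasDerivAt (fun t : ℝ => (t : ℂ)) 1 θ := Complex.ofRealCLM.hasDerivAt
    simpa [e] using! (h1.mul_const Complex.I).cexp
  have hγθ : ∀ t θ : ℝ, HasDerivAt (fun θ => γ t θ) (r t * (e θ * Complex.I)) θ := by
    intro t θ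
    exact ((heθ θ).const_mul (r t)).const_add _
  have hkt : ∀ t ∈ Icc (0 : ℝ) 1, ∀ θ, HasDerivAt (fun t => k t θ) (k' t θ) t := by
    intro t ht θ
    have h1 : HasDerivAt (fun t : ℝ => (t : ℂ)) 1 t := Complex.ofRealCLM.hasDerivAt
    have h2 : HasDerivAt r ((R₁ : ℂ) - R₀) t := by
      simpa [r] using! (h1.mul_const ((R₁ : ℂ) - R₀)).const_add (R₀ : ℂ)
    have h3 : HasDerivAt (fun t => G (γ t θ)) (u θ • deriv G (γ t θ)) t :=
      (hGd _ (hγU t ht θ)).scomp t (hγt t θ)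
    have h4 := (h2.mul_const (e θ * Complex.I)).smul h3
    rw [add_comm] at h4
    exact h4
  -- the `t`-derivative of the integrand is a total `θ`-derivative
  have hvθ : ∀ t ∈ Icc (0 : ℝ) 1, ∀ θ, HasDerivAt (fun θ => u θ • G (γ t θ)) (k' t θ) θ := by
    intro t ht θ
    have h2 : HasDerivAt u ((R₁ - R₀) * (e θ * Complex.I)) θ :=
      ((heθ θ).const_mul _).const_add _
    have h3 : HasDerivAt (fun θ => G (γ t θ))
        ((r t * (e θ * Complex.I)) • deriv G (γ t θ)) θ :=
      (hGd _ (hγU t ht θ)).scomp θ (hγθ t θ)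
    have h4 := h2.smul h3
    rw [add_comm, smul_comm] at h4
    exact h4
  have hzero : ∀ t ∈ Icc (0 : ℝ) 1, ∫ θ in (0 : ℝ)..2 * Real.pi, k' t θ = 0 := by
    intro t ht
    rw [intervalIntegral.integral_eq_sub_of_hasDerivAt (fun θ _ => hvθ t ht θ)
      ((hk'θ t ht).intervalIntegrable _ _)]
    have : e (2 * Real.pi) = e 0 := by
      simp [e]
    simp [u, γ, this]
  have hcpt : IsCompact (Icc (0 : ℝ) 1 ×ˢ Icc (0 : ℝ) (2 * Real.pi)) := isCompact_Icc.prod isCompact_Icc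
  have hsub : Icc (0 : ℝ) 1 ×ˢ Icc (0 : ℝ) (2 * Real.pi) ⊆ Icc (0 : ℝ) 1 ×ˢ univ :=
    prod_mono subset_rfl (subset_univ _)
  obtain ⟨B, hB⟩ := hcpt.exists_bound_of_continuousOn (hk'c.mono hsub)
  obtain ⟨B₀, hB₀⟩ := hcpt.exists_bound_of_continuousOn (hkc.mono hsub)
  have hmem : ∀ θ ∈ uIoc (0 : ℝ) (2 * Real.pi), θ ∈ Icc (0 : ℝ) (2 * Real.pi) := by
    intro θ hθ
    rw [uIoc_of_le Real.two_pi_pos.le] at hθ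
    exact Ioc_subset_Icc_self hθ
  let Φ : ℝ → E := fun t => ∫ θ in (0 : ℝ)..2 * Real.pi, k t θ
  have hΦd : ∀ t ∈ Ioo (0 : ℝ) 1, HasDerivAt Φ 0 t := by
    intro t ht
    have htc := Ioo_subset_Icc_self ht
    have := (intervalIntegral.hasDerivAt_integral_of_dominated_loc_of_deriv_le
      (μ := MeasureTheory.volume) (F := k) (F' := k') (x₀ := t) (a := 0) (b := 2 * Real.pi)
      (bound := fun _ => B) (s := Ioo 0 1) (isOpen_Ioo.mem_nhds ht)
      (by
        filter_upwards [isOpen_Ioo.mem_nhds ht] with x hx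
        exact (hkθ x (Ioo_subset_Icc_self hx)).aestronglyMeasurable)
      ((hkθ t htc).intervalIntegrable _ _)
      (hk'θ t htc).aestronglyMeasurable
      (Eventually.of_forall fun θ hθ x hx => hB (x, θ) ⟨Ioo_subset_Icc_self hx, hmem θ hθ⟩)
      intervalIntegrable_const
      (Eventually.of_forall fun θ _ x hx => hkt x (Ioo_subset_Icc_self hx) θ)).2
    rwa [hzero t htc] at this
  have hΦc : ContinuousOn Φ (Icc 0 1) := by
    intro t ht
    refine intervalIntegral.continuousWithinAt_of_dominated_interval (bound := fun _ => B₀)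
      ?_ ?_ intervalIntegrable_const ?_
    · filter_upwards [self_mem_nhdsWithin] with x hx
      exact (hkθ x hx).aestronglyMeasurable
    · filter_upwards [self_mem_nhdsWithin] with x hx
      exact Eventually.of_forall fun θ hθ => hB₀ (x, θ) ⟨hx, hmem θ hθ⟩
    · exact Eventually.of_forall fun θ _ => (hkt t ht θ).continuousAt.continuousWithinAt
  have hΦ : Φ 1 = Φ 0 := by
    have hconst : EqOn Φ (fun _ => Φ (1 / 2)) (Ioo 0 1) := fun t ht =>
      isOpen_Ioo.is_const_of_deriv_eq_zero isPreconnected_Ioo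
        (fun x hx => (hΦd x hx).differentiableAt.differentiableWithinAt)
        (fun x hx => (hΦd x hx).deriv) ht (by norm_num)
    have hcl : EqOn Φ (fun _ => Φ (1 / 2)) (Icc 0 1) :=
      hconst.of_subset_closure hΦc continuousOn_const Ioo_subset_Icc_self
        (by rw [closure_Ioo (by norm_num)])
    exact (hcl (by simp)).trans (hcl (by simp)).symm
  have hval : ∀ t ∈ Icc (0 : ℝ) 1,
      (∮ z in C(c₀ + t * (c₁ - c₀), R₀ + t * (R₁ - R₀)), G z) = Φ t := by
    intro t _
    simp only [circleIntegral, Φ]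
    refine intervalIntegral.integral_congr fun θ _ => ?_
    simp only [hγ, deriv_circleMap, k]
    simp [circleMap, r, e, mul_assoc]
  have e0 := hval 0 (by simp)
  have e1 := hval 1 (by simp)
  simp only [Complex.ofReal_zero, Complex.ofReal_one, zero_mul, one_mul, add_zero,
    add_sub_cancel] at e0 e1
  rw [e0, e1, hΦ]

/-- The Riesz integral does not depend on the circle. -/
theorem rieszIntegral_eq {M : H →L[ℂ] H} {g : ℂ → ℂ} (hg : DifferentiableOn ℂ g rightHalfPlane)
    {c₀ c₁ : ℂ} {R₀ R₁ : ℝ} (h₀ : IsRieszCircle M c₀ R₀) (h₁ : IsRieszCircle M c₁ R₁) :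
    rieszIntegral M g c₀ R₀ = rieszIntegral M g c₁ R₁ := by
  have hopen : IsOpen rightHalfPlane := isOpen_lt continuous_const Complex.continuous_re
  have hU : IsOpen (rightHalfPlane ∩ (spectrum ℂ M)ᶜ) :=
    hopen.inter (spectrum.isClosed M).isOpen_compl
  unfold rieszIntegral
  congr 1
  refine circleIntegral_eq_of_homotopy hU ?_ fun t ht θ => ⟨?_, fun hmem => ?_⟩
  · intro z hz
    refine ((hg.differentiableAt (hopen.mem_nhds hz.1)).smul ?_).differentiableWithinAt
    exact (spectrum.hasDerivAt_resolvent_const_left (not_not.1 hz.2)).differentiableAt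
  · have p0 : circleMap c₀ R₀ θ ∈ rightHalfPlane :=
      h₀.closedBall_subset (circleMap_mem_closedBall c₀ h₀.pos.le θ)
    have p1 : circleMap c₁ R₁ θ ∈ rightHalfPlane :=
      h₁.closedBall_subset (circleMap_mem_closedBall c₁ h₁.pos.le θ)
    have hc : Convex ℝ rightHalfPlane := convex_halfSpace_re_gt 0
    have := hc.add_smul_sub_mem p0 p1 ht
    convert this using 1
    simp [circleMap]
    ring
  · have m0 := h₀.spectrum_subset hmem
    have m1 := h₁.spectrum_subset hmem
    rw [mem_ball, dist_eq_norm] at m0 m1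
    have hRt : 0 < R₀ + t * (R₁ - R₀) := by
      have := h₀.pos
      have := h₁.pos
      nlinarith [ht.1, ht.2, mul_nonneg ht.1 h₁.pos.le, mul_nonneg (sub_nonneg.2 ht.2) h₀.pos.le]
    set w := circleMap (c₀ + t * (c₁ - c₀)) (R₀ + t * (R₁ - R₀)) θ with hw
    have hd : ‖w - (c₀ + t * (c₁ - c₀))‖ = R₀ + t * (R₁ - R₀) := by
      rw [hw, circleMap_sub_center]
      simpa using abs_of_pos hRt
    have hsplit : w - (c₀ + t * (c₁ - c₀)) = ((1 - t : ℝ) : ℂ) * (w - c₀) + (t : ℝ) * (w - c₁) := by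
      push_cast; ring
    have hn := norm_add_le (((1 - t : ℝ) : ℂ) * (w - c₀)) ((t : ℝ) * (w - c₁))
    rw [← hsplit, hd, norm_mul, norm_mul, Complex.norm_real, Complex.norm_real,
      Real.norm_of_nonneg (sub_nonneg.2 ht.2), Real.norm_of_nonneg ht.1] at hn
    rcases eq_or_lt_of_le ht.1 with h0 | h0
    · subst h0; linarith
    · nlinarith [mul_lt_mul_of_pos_left m1 h0,
        mul_le_mul_of_nonneg_left m0.le (sub_nonneg.2 ht.2)]

/-- The operator `g(M)` is the Riesz integral over any circle in `ℂ_+` that encloses `σ(M)`. -/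
theorem rieszCalculus_eq {M : H →L[ℂ] H} {g : ℂ → ℂ} (hg : DifferentiableOn ℂ g rightHalfPlane)
    {c : ℂ} {R : ℝ} (h : IsRieszCircle M c R) : rieszCalculus M g = rieszIntegral M g c R := by
  have hex : ∃ p : ℂ × ℝ, IsRieszCircle M p.1 p.2 := ⟨(c, R), h⟩
  rw [rieszCalculus, dif_pos hex]
  exact rieszIntegral_eq hg hex.choose_spec h

end RieszFacts

end SchurAgler

namespace SchurAgler

/-! ### Riesz integrals of the resolvent and of powers -/

section RieszExp

variable {H : Type u} [NormedAddCommGroup H] [InnerProductSpace ℂ H] [CompleteSpace H]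

/-! The operators `p_j^{-M}` are the exponentials `exp(a_j M)` with `a_j = -log p_j`. They commute,
and by hypothesis they are contractions, so the von Neumann inequality that defines the Agler class
is available once they are scaled by some `r < 1`. What remains is to identify power series in these
operators with Riesz integrals and to pass to two limits.

For the identification, `rieszIntegral_cexp` gives `exp(aM)` as the Riesz integral of `exp(az)`. A
monomial in the operators `r exp(a_j M)` is a scalar times a single exponential of a multiple of
`M`, and the same holds for the corresponding scalar monomial. Integrating the power series term by
term against the resolvent therefore gives the value of the power series at the tuple
(`AglerClass.norm_rieszIntegral_le_of_lt_one`). Multiplicativity of the general Riesz calculus is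
never needed; the group law of the exponential replaces it.

The limits are `r → 1`, and then the number of variables `N → ∞`. On the compact contour the
resolvent is bounded and all the functions have modulus at most 1, so pointwise convergence on the
circle gives norm convergence of the Riesz integrals (`tendsto_rieszIntegral`), and the bound 1
survives. -/

theorem continuousOn_resolvent (M : H →L[ℂ] H) : ContinuousOn (resolvent M) (resolventSet ℂ M) :=
  fun _ hz => (spectrum.hasDerivAt_resolvent_const_left hz).continuousAt.continuousWithinAt

omit [CompleteSpace H] in
theorem IsRieszCircle.sphere_subset {M : H →L[ℂ] H} {c : ℂ} {R : ℝ} (h : IsRieszCircle M c R) :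
    sphere c R ⊆ resolventSet ℂ M := by
  intro z hz
  by_contra hn
  exact (mem_ball.1 (h.spectrum_subset hn)).ne (mem_sphere.1 hz)

-- Split `z - w = (z - M) + (M - w)`; the first summand cancels the resolvent. The choice `w = c`
-- compares the resolvent with `(z - c)⁻¹`, and `w = 0` gives the recursion for powers.
omit [CompleteSpace H] in
theorem smul_resolvent_eq {M : H →L[ℂ] H} {z : ℂ} (hz : z ∈ resolventSet ℂ M) (w : ℂ) :
    (z - w) • resolvent M z = 1 + (M - algebraMap ℂ (H →L[ℂ] H) w) * resolvent M z := by
  have h := Ring.mul_inverse_cancel _ (spectrum.mem_resolventSet_iff.1 hz)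
  change (algebraMap ℂ (H →L[ℂ] H) z - M) * resolvent M z = 1 at h
  rw [← h, Algebra.smul_def, map_sub]
  noncomm_ring

theorem circleIntegral_const_mul (A : H →L[ℂ] H) {G : ℂ → (H →L[ℂ] H)} {c : ℂ} {R : ℝ}
    (hG : CircleIntegrable G c R) : (∮ z in C(c, R), A * G z) = A * ∮ z in C(c, R), G z := by
  have := ((ContinuousLinearMap.mul ℂ (H →L[ℂ] H)) A).intervalIntegral_comp_comm hG.out
  simpa [circleIntegral] using this

/-- The integral of the resolvent over a circle that encloses the spectrum. -/
theorem circleIntegral_resolvent {M : H →L[ℂ] H} {c : ℂ} {R : ℝ} (hR : 0 < R)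
    (hs : spectrum ℂ M ⊆ ball c R) :
    (∮ z in C(c, R), resolvent M z) = (2 * (Real.pi : ℂ) * Complex.I) • (1 : H →L[ℂ] H) := by
  set A : H →L[ℂ] H := M - algebraMap ℂ (H →L[ℂ] H) c with hA
  have hres : ∀ r, R ≤ r → sphere c r ⊆ resolventSet ℂ M := by
    intro r hr z hz
    by_contra hn
    have := mem_ball.1 (hs hn)
    rw [mem_sphere.1 hz] at this
    linarith
  have hmove : ∀ r, R ≤ r → (∮ z in C(c, R), resolvent M z) = ∮ z in C(c, r), resolvent M z := by
    intro r hr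
    -- The circles stay concentric with radii at least `R`, so they never meet the spectrum. They
    -- may leave the right half plane, which is harmless because the resolvent alone is integrated.
    refine circleIntegral_eq_of_homotopy (spectrum.isOpen_resolventSet M)
      (fun z hz => (spectrum.hasDerivAt_resolvent_const_left hz).differentiableAt
        |>.differentiableWithinAt) fun t ht θ => ?_
    have hρ : R ≤ R + t * (r - R) := by nlinarith [ht.1]
    rw [sub_self, mul_zero, add_zero]
    refine hres _ hρ ?_
    have := circleMap_mem_sphere c (hR.le.trans hρ) θ
    exact_mod_cast this
  have hle : ∀ ε : ℝ, 0 < ε →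
      ‖(∮ z in C(c, R), resolvent M z) - (2 * (Real.pi : ℂ) * Complex.I) • (1 : H →L[ℂ] H)‖ ≤
        2 * Real.pi * ‖A‖ * ε := by
    intro ε hε
    -- The resolvent vanishes at infinity, so on a large enough circle its norm is below `ε`.
    have hev := (spectrum.resolvent_tendsto_cobounded (𝕜 := ℂ) M).norm.eventually
      (gt_mem_nhds (by simpa using hε))
    obtain ⟨ρ, -, hρ⟩ := (hasBasis_cobounded_compl_closedBall c).eventually_iff.1 hev
    obtain ⟨r, hr⟩ := exists_gt (max R ρ)
    have hRr : R < r := (le_max_left _ _).trans_lt hr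
    have hr0 : 0 < r := hR.trans hRr
    have hcint : CircleIntegrable (fun z => (z - c)⁻¹ • (1 : H →L[ℂ] H)) c r := by
      have hinv : ContinuousOn (fun z => (z - c)⁻¹) (sphere c r) :=
        ContinuousOn.inv₀ (by fun_prop) fun z hz => sub_ne_zero.2 (ne_of_mem_sphere hz hr0.ne')
      exact ContinuousOn.circleIntegrable hr0.le (by fun_prop)
    have hrint : CircleIntegrable (resolvent M) c r :=
      ((continuousOn_resolvent M).mono (hres r hRr.le)).circleIntegrable hr0.le
    have h1 : (∮ z in C(c, r), (z - c)⁻¹ • (1 : H →L[ℂ] H)) =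
        (2 * (Real.pi : ℂ) * Complex.I) • (1 : H →L[ℂ] H) := by
      rw [circleIntegral.integral_smul_const, circleIntegral.integral_sub_center_inv c hr0.ne']
    rw [hmove r hRr.le, ← h1, ← circleIntegral.integral_sub hrint hcint]
    -- The difference of the integrands is `(z - c)⁻¹ A (z - M)⁻¹`, of norm at most `‖A‖ ε / r`; the
    -- length `2πr` cancels the `r`.
    refine (circleIntegral.norm_integral_le_of_norm_le_const (C := ‖A‖ * ε / r) hr0.le
      fun z hz => ?_).trans_eq (by field_simp)
    have hne : z - c ≠ 0 := sub_ne_zero.2 (ne_of_mem_sphere hz hr0.ne')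
    have hzr : ‖z - c‖ = r := mem_sphere_iff_norm.1 hz
    have hz' : ‖resolvent M z‖ < ε := by
      refine hρ ?_
      rw [mem_compl_iff, mem_closedBall, mem_sphere.1 hz, not_le]
      exact (le_max_right _ _).trans_lt hr
    have heq : resolvent M z - (z - c)⁻¹ • (1 : H →L[ℂ] H) = (z - c)⁻¹ • (A * resolvent M z) := by
      rw [eq_inv_smul_iff₀ hne, smul_sub, smul_inv_smul₀ hne, smul_resolvent_eq (hres r hRr.le hz),
        add_sub_cancel_left]
    rw [heq, norm_smul, norm_inv, hzr, inv_mul_eq_div]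
    gcongr
    exact (norm_mul_le _ _).trans (by gcongr)
  refine sub_eq_zero.1 (norm_le_zero_iff.1 ?_)
  have hlim : Tendsto (fun ε : ℝ => 2 * Real.pi * ‖A‖ * ε) (𝓝[>] 0)
      (𝓝 (2 * Real.pi * ‖A‖ * 0)) :=
    ((continuous_const.mul continuous_id).tendsto 0).mono_left nhdsWithin_le_nhds
  rw [mul_zero] at hlim
  refine ge_of_tendsto hlim ?_
  filter_upwards [self_mem_nhdsWithin] with ε hε using hle ε hε

theorem circleIntegrable_smul_resolvent {M : H →L[ℂ] H} {c : ℂ} {R : ℝ} (h : IsRieszCircle M c R)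
    {g : ℂ → ℂ} (hg : ContinuousOn g (sphere c R)) :
    CircleIntegrable (fun z => g z • resolvent M z) c R :=
  (hg.smul ((continuousOn_resolvent M).mono h.sphere_subset)).circleIntegrable h.pos.le

omit [CompleteSpace H] in
theorem rieszIntegral_congr {M : H →L[ℂ] H} {c : ℂ} {R : ℝ} (h : IsRieszCircle M c R)
    {g₁ g₂ : ℂ → ℂ} (hg : EqOn g₁ g₂ (sphere c R)) :
    rieszIntegral M g₁ c R = rieszIntegral M g₂ c R := by
  unfold rieszIntegral
  congr 1
  exact circleIntegral.integral_congr h.pos.le fun z hz => by simp only [hg hz]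

theorem rieszIntegral_const_mul (M : H →L[ℂ] H) (a : ℂ) (g : ℂ → ℂ) (c : ℂ) (R : ℝ) :
    rieszIntegral M (fun z => a * g z) c R = a • rieszIntegral M g c R := by
  unfold rieszIntegral
  simp_rw [mul_smul]
  rw [circleIntegral.integral_smul, smul_comm]

/-- Induction from `z (z - M)⁻¹ = 1 + M (z - M)⁻¹`: multiplied by `z ^ k`, the first term is entire
and integrates to zero by Cauchy, and the second pulls out a factor `M`. -/
theorem rieszIntegral_pow {M : H →L[ℂ] H} {c : ℂ} {R : ℝ} (h : IsRieszCircle M c R) (k : ℕ) :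
    rieszIntegral M (fun z => z ^ k) c R = M ^ k := by
  induction k with
  | zero =>
    have h2 : (2 * (Real.pi : ℂ) * Complex.I) ≠ 0 := Complex.two_pi_I_ne_zero
    simp [rieszIntegral, circleIntegral_resolvent h.pos h.spectrum_subset, smul_smul, h2,
      -mul_inv_rev]
  | succ k ih =>
    have hint := circleIntegrable_smul_resolvent h (g := fun z => z ^ k) (by fun_prop)
    have hzero : (∮ z in C(c, R), z ^ k • (1 : H →L[ℂ] H)) = 0 := by
      rw [circleIntegral.integral_smul_const,
        Complex.circleIntegral_eq_zero_of_differentiable_on_off_countable h.pos.le countable_empty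
          (by fun_prop) (fun z _ => by fun_prop), zero_smul]
    have hcong : (∮ z in C(c, R), z ^ (k + 1) • resolvent M z) =
        ∮ z in C(c, R), (z ^ k • (1 : H →L[ℂ] H) + M * (z ^ k • resolvent M z)) := by
      refine circleIntegral.integral_congr h.pos.le fun z hz => ?_
      have := smul_resolvent_eq (h.sphere_subset hz) 0
      rw [sub_zero, map_zero, sub_zero] at this
      change z ^ (k + 1) • _ = _
      rw [pow_succ, mul_smul, this, smul_add, mul_smul_comm]
    have hMint : CircleIntegrable (fun z => M * (z ^ k • resolvent M z)) c R := by
      have hres := (continuousOn_resolvent M).mono h.sphere_subset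
      exact ContinuousOn.circleIntegrable h.pos.le (by fun_prop)
    have hoint : CircleIntegrable (fun z => z ^ k • (1 : H →L[ℂ] H)) c R :=
      ContinuousOn.circleIntegrable h.pos.le (by fun_prop)
    rw [pow_succ', ← ih]
    unfold rieszIntegral
    rw [hcong, circleIntegral.integral_add hoint hMint, hzero, zero_add,
      circleIntegral_const_mul M hint, mul_smul_comm]

/-! ### Limits and series under the Riesz integral -/

theorem IsRieszCircle.exists_norm_resolvent_le {M : H →L[ℂ] H} {c : ℂ} {R : ℝ}
    (h : IsRieszCircle M c R) : ∃ B, ∀ z ∈ sphere c R, ‖resolvent M z‖ ≤ B :=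
  (isCompact_sphere c R).exists_bound_of_continuousOn
    ((continuousOn_resolvent M).mono h.sphere_subset)

theorem IsRieszCircle.continuous_integrand {M : H →L[ℂ] H} {c : ℂ} {R : ℝ}
    (h : IsRieszCircle M c R) {g : ℂ → ℂ} (hg : ContinuousOn g (sphere c R)) :
    Continuous fun θ : ℝ => deriv (circleMap c R) θ •
      (g (circleMap c R θ) • resolvent M (circleMap c R θ)) := by
  have hc : Continuous (circleMap c R) := continuous_circleMap c R
  have hmem : ∀ θ, circleMap c R θ ∈ sphere c R := circleMap_mem_sphere c h.pos.le
  have h1 := hg.comp_continuous hc hmem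
  have h2 := ((continuousOn_resolvent M).mono h.sphere_subset).comp_continuous hc hmem
  have h0 : Continuous fun θ => circleMap 0 R θ * Complex.I := by fun_prop
  simp only [deriv_circleMap]
  exact h0.smul (h1.smul h2)

/-- The Riesz integral of a uniformly and absolutely convergent series of functions. -/
theorem hasSum_rieszIntegral {M : H →L[ℂ] H} {c : ℂ} {R : ℝ} (h : IsRieszCircle M c R)
    {ι : Type*} [Countable ι] {g : ι → ℂ → ℂ} {G : ℂ → ℂ} {b : ι → ℝ}
    (hg : ∀ i, ContinuousOn (g i) (sphere c R)) (hgb : ∀ i, ∀ z ∈ sphere c R, ‖g i z‖ ≤ b i)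
    (hb : Summable b) (hG : ∀ z ∈ sphere c R, HasSum (fun i => g i z) (G z)) :
    HasSum (fun i => rieszIntegral M (g i) c R) (rieszIntegral M G c R) := by
  obtain ⟨B, hB⟩ := h.exists_norm_resolvent_le
  have hmem : ∀ θ, circleMap c R θ ∈ sphere c R := circleMap_mem_sphere c h.pos.le
  refine HasSum.const_smul _ ?_
  -- Here `|R|` is the speed of the circle parametrisation and `B` bounds the resolvent on the
  -- circle.
  refine intervalIntegral.hasSum_integral_of_dominated_convergence (fun i _ => |R| * (b i * B))
    (fun i => (h.continuous_integrand (hg i)).aestronglyMeasurable)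
    (fun i => Eventually.of_forall fun θ _ => ?_)
    (Eventually.of_forall fun θ _ => (hb.mul_right B).mul_left _) intervalIntegrable_const
    (Eventually.of_forall fun θ _ => ((hG _ (hmem θ)).smul_const _).const_smul _)
  rw [norm_smul, norm_smul]
  refine mul_le_mul (by simp) (mul_le_mul (hgb i _ (hmem θ)) (hB _ (hmem θ)) (norm_nonneg _)
    ((norm_nonneg _).trans (hgb i _ (hmem θ)))) (by positivity) (abs_nonneg _)

/-- The Riesz integral of a boundedly and pointwise convergent family of functions. -/
theorem tendsto_rieszIntegral {M : H →L[ℂ] H} {c : ℂ} {R : ℝ} (h : IsRieszCircle M c R)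
    {ι : Type*} {l : Filter ι} [l.IsCountablyGenerated] {g : ι → ℂ → ℂ} {G : ℂ → ℂ} {C : ℝ}
    (hg : ∀ᶠ i in l, ContinuousOn (g i) (sphere c R))
    (hgC : ∀ᶠ i in l, ∀ z ∈ sphere c R, ‖g i z‖ ≤ C)
    (hG : ∀ z ∈ sphere c R, Tendsto (fun i => g i z) l (𝓝 (G z))) :
    Tendsto (fun i => rieszIntegral M (g i) c R) l (𝓝 (rieszIntegral M G c R)) := by
  obtain ⟨B, hB⟩ := h.exists_norm_resolvent_le
  have hmem : ∀ θ, circleMap c R θ ∈ sphere c R := circleMap_mem_sphere c h.pos.le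
  refine Tendsto.const_smul ?_ _
  refine intervalIntegral.tendsto_integral_filter_of_dominated_convergence
    (fun _ => |R| * (C * B))
    (hg.mono fun i hi => (h.continuous_integrand hi).aestronglyMeasurable)
    (hgC.mono fun i hi => Eventually.of_forall fun θ _ => ?_) intervalIntegrable_const
    (Eventually.of_forall fun θ _ => ((hG _ (hmem θ)).smul_const _).const_smul _)
  rw [norm_smul, norm_smul]
  refine mul_le_mul (by simp) (mul_le_mul (hi _ (hmem θ)) (hB _ (hmem θ)) (norm_nonneg _)
    ((norm_nonneg _).trans (hi _ (hmem θ)))) (by positivity) (abs_nonneg _)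

/-! ### Exponentials in the Riesz calculus -/

/-- The exponential series converges uniformly on the circle, where `‖z‖ ≤ ‖c‖ + R`, so it can be
integrated term by term with `rieszIntegral_pow`. -/
theorem rieszIntegral_cexp {M : H →L[ℂ] H} {c : ℂ} {R : ℝ} (h : IsRieszCircle M c R) (a : ℂ) :
    rieszIntegral M (fun z => Complex.exp (a * z)) c R = NormedSpace.exp (a • M) := by
  have h1 : HasSum (fun k : ℕ => rieszIntegral M (fun z => (k.factorial : ℂ)⁻¹ * a ^ k * z ^ k) c R)
      (rieszIntegral M (fun z => Complex.exp (a * z)) c R) := by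
    refine hasSum_rieszIntegral h (b := fun k => (k.factorial : ℝ)⁻¹ * (‖a‖ * (‖c‖ + R)) ^ k)
      (fun k => by fun_prop) (fun k z hz => ?_)
      (NormedSpace.expSeries_summable' (𝕂 := ℝ) (‖a‖ * (‖c‖ + R))) fun z _ => ?_
    · have hz' : ‖z‖ ≤ ‖c‖ + R := by
        have := norm_add_le c (z - c)
        rwa [add_sub_cancel, mem_sphere_iff_norm.1 hz] at this
      rw [norm_mul, norm_mul, norm_inv, norm_pow, norm_pow, Complex.norm_natCast, mul_assoc,
        mul_pow]
      gcongr
    · have := NormedSpace.exp_series_hasSum_exp' (𝕂 := ℂ) (a * z)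
      rw [← Complex.exp_eq_exp_ℂ] at this
      refine this.congr_fun fun k => ?_
      rw [smul_eq_mul, mul_pow, mul_assoc]
  refine h1.unique ((NormedSpace.exp_series_hasSum_exp' (𝕂 := ℂ) (a • M)).congr_fun fun k => ?_)
  rw [rieszIntegral_const_mul, rieszIntegral_pow h, smul_pow, smul_smul]

end RieszExp

/-! ### The Agler bound in finitely many variables -/

section AglerBound

variable {H : Type u} [NormedAddCommGroup H] [InnerProductSpace ℂ H] [CompleteSpace H]

theorem exp_add_smul (M : H →L[ℂ] H) (a b : ℂ) :
    NormedSpace.exp ((a + b) • M) = NormedSpace.exp (a • M) * NormedSpace.exp (b • M) := by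
  let _ : NormedAlgebra ℚ (H →L[ℂ] H) := NormedAlgebra.restrictScalars ℚ ℂ _
  rw [add_smul, NormedSpace.exp_add_of_commute (((Commute.refl M).smul_left a).smul_right b)]

theorem exp_natCast_mul_smul (M : H →L[ℂ] H) (n : ℕ) (a : ℂ) :
    NormedSpace.exp ((n * a) • M) = NormedSpace.exp (a • M) ^ n := by
  let _ : NormedAlgebra ℚ (H →L[ℂ] H) := NormedAlgebra.restrictScalars ℚ ℂ _
  rw [mul_smul, Nat.cast_smul_eq_nsmul, NormedSpace.exp_nsmul]

/-- The group law collapses a product of exponentials of multiples of `M` into one exponential,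
which `rieszIntegral_cexp` recognises as a Riesz integral. -/
theorem opMonomial_smul_exp (M : H →L[ℂ] H) (r : ℂ) {N : ℕ} (a : Fin N → ℂ) (α : Fin N → ℕ) :
    opMonomial (fun j => r • NormedSpace.exp (a j • M)) α =
      (∏ j, r ^ α j) • NormedSpace.exp ((∑ j, α j * a j) • M) := by
  induction N with
  | zero => simp [opMonomial]
  | succ N ih =>
    have := ih (fun j => a j.succ) (fun j => α j.succ)
    unfold opMonomial at this ⊢
    rw [List.ofFn_succ, List.prod_cons, this, Fin.prod_univ_succ, Fin.sum_univ_succ, exp_add_smul,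
      exp_natCast_mul_smul, smul_pow, smul_mul_smul_comm]

/-- The Riesz integral is the power series of `f` evaluated at the commuting strict contractions `r
exp(a_j M)`, so the defining inequality of the Agler class applies. -/
theorem AglerClass.norm_rieszIntegral_le_of_lt_one {N : ℕ} {f : (Fin N → ℂ) → ℂ}
    (hf : AglerClass.{u} N f) {M : H →L[ℂ] H} {c : ℂ} {R : ℝ} (h : IsRieszCircle M c R)
    {a : Fin N → ℂ} (haM : ∀ j, ‖NormedSpace.exp (a j • M)‖ ≤ 1)
    (ha : ∀ j, ∀ z ∈ sphere c R, ‖Complex.exp (a j * z)‖ ≤ 1) {r : ℝ} (hr0 : 0 ≤ r) (hr1 : r < 1) :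
    ‖rieszIntegral M (fun z => f fun j => r * Complex.exp (a j * z)) c R‖ ≤ 1 := by
  obtain ⟨k, hk⟩ := hf.schur.exists_isPowerSeries
  set T : Fin N → (H →L[ℂ] H) := fun j => (r : ℂ) • NormedSpace.exp (a j • M) with hT
  have hrn : ‖(r : ℂ)‖ = r := by rw [Complex.norm_real, Real.norm_of_nonneg hr0]
  have hcomm : ∀ i j, Commute (T i) (T j) := fun i j => by
    refine Commute.smul_right (Commute.smul_left ?_ _) _
    rw [Commute, SemiconjBy, ← exp_add_smul, ← exp_add_smul, add_comm]
  have hlt : ∀ j, ‖T j‖ < 1 := fun j => by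
    rw [hT, norm_smul, hrn]
    nlinarith [haM j, norm_nonneg (NormedSpace.exp (a j • M))]
  have hexp : ∀ (α : Fin N → ℕ) (z : ℂ), ∏ j, ((r : ℂ) * Complex.exp (a j * z)) ^ α j =
      (∏ j, (r : ℂ) ^ α j) * Complex.exp ((∑ j, α j * a j) * z) := fun α z => by
    simp_rw [mul_pow, Finset.prod_mul_distrib, Finset.sum_mul, Complex.exp_sum,
      ← Complex.exp_nat_mul, mul_assoc]
  have hmem : ∀ z ∈ sphere c R, (fun j => r * Complex.exp (a j * z)) ∈ polydisc N :=
    fun z hz j => by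
      rw [norm_mul, hrn]
      nlinarith [ha j z hz, norm_nonneg (Complex.exp (a j * z))]
  have hsum : HasSum (fun α => rieszIntegral M
      (fun z => k α * ∏ j, ((r : ℂ) * Complex.exp (a j * z)) ^ α j) c R)
      (rieszIntegral M (fun z => f fun j => r * Complex.exp (a j * z)) c R) := by
    refine hasSum_rieszIntegral h (b := fun α => ‖k α * ∏ j, (r : ℂ) ^ α j‖)
      (fun α => by fun_prop) (fun α z hz => ?_)
      -- Absolute convergence at the single point `(r, …, r)` dominates the series on the whole
      -- circle, because the exponentials have modulus at most 1 there.
      (hk (fun _ => (r : ℂ)) (fun _ => hrn.trans_lt hr1)).summable.norm fun z hz => hk _ (hmem z hz)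
    rw [norm_mul, norm_mul, norm_prod, norm_prod]
    gcongr with j
    rw [norm_pow, norm_pow, norm_mul]
    gcongr
    exact mul_le_of_le_one_right (norm_nonneg _) (ha j z hz)
  have heq : opPowerSeries k T =
      rieszIntegral M (fun z => f fun j => r * Complex.exp (a j * z)) c R := by
    refine HasSum.tsum_eq (hsum.congr_fun fun α => ?_)
    simp_rw [hexp, ← mul_assoc]
    rw [rieszIntegral_const_mul, rieszIntegral_cexp h, opMonomial_smul_exp, smul_smul]
  exact heq ▸ hf.vonNeumann k hk H T hcomm hlt

theorem SchurClass.continuousOn_comp_cexp {N : ℕ} {f : (Fin N → ℂ) → ℂ} (hf : SchurClass N f)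
    {a : Fin N → ℂ} {r : ℂ} {s : Set ℂ}
    (hs : ∀ z ∈ s, (fun j => r * Complex.exp (a j * z)) ∈ polydisc N) :
    ContinuousOn (fun z => f fun j => r * Complex.exp (a j * z)) s :=
  hf.analytic.continuousOn.comp (by fun_prop) hs

/-- The operators `exp(a_j M)` may have norm exactly 1, which excludes a direct use of the Agler
inequality; hence the limit `r → 1`. The scalar values are strictly inside the polydisc on the
circle, so `f` is continuous at the limit points. -/
theorem AglerClass.norm_rieszIntegral_le {N : ℕ} {f : (Fin N → ℂ) → ℂ}
    (hf : AglerClass.{u} N f) {M : H →L[ℂ] H} {c : ℂ} {R : ℝ} (h : IsRieszCircle M c R)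
    {a : Fin N → ℂ} (haM : ∀ j, ‖NormedSpace.exp (a j • M)‖ ≤ 1)
    (ha : ∀ j, ∀ z ∈ sphere c R, ‖Complex.exp (a j * z)‖ < 1) :
    ‖rieszIntegral M (fun z => f fun j => Complex.exp (a j * z)) c R‖ ≤ 1 := by
  have hr : ∀ᶠ r : ℝ in 𝓝[<] 1, r ∈ Ioo (0 : ℝ) 1 := Ioo_mem_nhdsLT (zero_lt_one' ℝ)
  have hmem : ∀ r ∈ Ioo (0 : ℝ) 1, ∀ z ∈ sphere c R,
      (fun j => (r : ℂ) * Complex.exp (a j * z)) ∈ polydisc N := fun r hr z hz j => by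
    rw [norm_mul, Complex.norm_real, Real.norm_of_nonneg hr.1.le]
    nlinarith [ha j z hz, hr.1, hr.2]
  have hlim := tendsto_rieszIntegral h (l := 𝓝[<] (1 : ℝ)) (C := 1)
    (g := fun r z => f fun j => r * Complex.exp (a j * z))
    (G := fun z => f fun j => Complex.exp (a j * z))
    (hr.mono fun r hr => hf.schur.continuousOn_comp_cexp (hmem r hr))
    (hr.mono fun r hr z hz => hf.schur.norm_le_one _ (hmem r hr z hz))
    (fun z hz => by
      refine (hf.schur.analytic _ fun j => ha j z hz).continuousAt.tendsto.comp ?_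
      have hc : Continuous fun r : ℝ => fun j => (r : ℂ) * Complex.exp (a j * z) := by fun_prop
      simpa using (hc.tendsto 1).mono_left nhdsWithin_le_nhds)
  refine le_of_tendsto hlim.norm (hr.mono fun r hr => ?_)
  exact hf.norm_rieszIntegral_le_of_lt_one h haM (fun j z hz => (ha j z hz).le) hr.1.le hr.2

/-! ### Infinitely many variables and Dirichlet series -/

theorem natCast_cpow_neg {n : ℕ} (hn : n ≠ 0) (s : ℂ) :
    (n : ℂ) ^ (-s) = Complex.exp (-Complex.log n * s) := by
  rw [Complex.cpow_def_of_ne_zero (by exact_mod_cast hn), mul_neg, neg_mul]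

/-- The truncation of `F` to the first `N` primes satisfies the finite bound. Truncations are
bounded by 1 and converge pointwise on the circle because `p_j^{-s} → 0`, so the bound passes to the
limit. -/
theorem AglerClassInfty.norm_rieszIntegral_extend_le {F : (ℕ →₀ ℂ) → ℂ}
    (hF : AglerClassInfty.{u} F) {M : H →L[ℂ] H} {c : ℂ} {R : ℝ} (h : IsRieszCircle M c R)
    (hM : ∀ p : ℕ, p.Prime → ‖rieszIntegral M (fun s : ℂ => (p : ℂ) ^ (-s)) c R‖ ≤ 1) :
    ‖rieszIntegral M (fun s => extend F (primePowers s)) c R‖ ≤ 1 := by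
  have hpos : ∀ z ∈ sphere c R, z ∈ rightHalfPlane := fun z hz =>
    h.closedBall_subset (sphere_subset_closedBall hz)
  have hp : ∀ j, (Nat.nth Nat.Prime j).Prime := Nat.prime_nth_prime
  set a : ℕ → ℂ := fun j => -Complex.log (Nat.nth Nat.Prime j : ℕ) with ha
  have hpa : ∀ j s, primePowers s j = Complex.exp (a j * s) := fun j s =>
    natCast_cpow_neg (hp j).ne_zero s
  have hpow : ∀ s, ∀ N : ℕ, (fun j : Fin N => primePowers s j) =
      fun j : Fin N => Complex.exp (a j * s) := fun s N => funext fun j => hpa j s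
  have hlt : ∀ j, ∀ z ∈ sphere c R, ‖Complex.exp (a j * z)‖ < 1 := fun j z hz =>
    hpa j z ▸ norm_primePowers_lt_one (hpos z hz) j
  have hexp : ∀ j, ‖NormedSpace.exp (a j • M)‖ ≤ 1 := fun j => by
    rw [← rieszIntegral_cexp h]
    simpa only [natCast_cpow_neg (hp j).ne_zero] using hM _ (hp j)
  have hlim := tendsto_rieszIntegral h (l := atTop) (C := 1)
    (g := fun (N : ℕ) s => F (padZero N fun j => primePowers s j))
    (G := fun s => extend F (primePowers s))
    (Eventually.of_forall fun N => by
      simp_rw [hpow]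
      simpa using (hF N).schur.continuousOn_comp_cexp (a := fun j : Fin N => a j) (r := 1)
        (fun z hz j => by simpa using hlt j z hz))
    (Eventually.of_forall fun N z hz => (hF N).schur.norm_le_one _
      fun j => norm_primePowers_lt_one (hpos z hz) j)
    (fun z hz => hF.tendsto_extend (norm_primePowers_lt_one (hpos z hz))
      (tendsto_primePowers (hpos z hz)))
  refine le_of_tendsto hlim.norm (Eventually.of_forall fun N => ?_)
  simp_rw [hpow]
  exact (hF N).norm_rieszIntegral_le h (fun j => hexp j) fun j => hlt j

end AglerBound

end SchurAgler

theorem theorem1p5 {H : Type u} [NormedAddCommGroup H] [InnerProductSpace ℂ H] [CompleteSpace H]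
    (f : ℂ → ℂ) (hf : f ∈ SchurAgler.DirichletAgler.{u})
    (M : H →L[ℂ] H) (hM : spectrum ℂ M ⊆ SchurAgler.rightHalfPlane)
    (hn : ∀ n : ℕ, 1 ≤ n → ‖SchurAgler.rieszCalculus M (fun s : ℂ => (n : ℂ) ^ (-s))‖ ≤ 1) :
    ‖SchurAgler.rieszCalculus M f‖ ≤ 1 := by
  obtain ⟨F, hF, hfF⟩ := hf
  have hex := SchurAgler.exists_isRieszCircle hM
  have h := hex.choose_spec
  -- The chosen circle depends on `M` alone, so the hypothesis on `n^{-M}` and the goal become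
  -- integrals over one and the same contour.
  simp only [SchurAgler.rieszCalculus, dif_pos hex] at hn ⊢
  rw [SchurAgler.rieszIntegral_congr h fun z hz =>
    hfF z (h.closedBall_subset (sphere_subset_closedBall hz))]
  exact hF.norm_rieszIntegral_extend_le h fun p hp => hn p hp.one_lt.le
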